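/- Let $\mathcal H$ be a finite-dimensional complex Hilbert space. For density operators $\rho,\sigma$ on $\mathcal H$ let $$D(\rho\|\sigma)=\operatorname{Tr}\bigl[\rho(\log\rho-\log\sigma)\bigr]\ \text{ if }\operatorname{supp}\rho\subseteq\operatorname{supp}\sigma,\qquad D(\rho\|\sigma)=+\infty\ \text{ otherwise}$$ be the quantum relative entropy, and for a real function $I$ on $[0,\infty)$ let the backflow functional be $$N_I=\int_0^\infty \Theta(\dot I(t))\,\dot I(t)\,dt\in[0,\infty],$$ where $\Theta$ is the Heaviside step function (times at which $I$ is not differentiable contribute nothing). Let $(\Phi(t,0))_{t\ge 0}$ be a family of completely positive trace-preserving (CPTP) linear maps on the operators on $\mathcal H$ (for instance the family generated by a time-convolutionless master equation $\dot\rho_R(t)=\mathcal G(t)\rho_R(t)$) which is CP-divisible: for all $t\ge s\ge 0$ there is a CPTP map $\Phi(t,s)$ with $\Phi(t,0)=\Phi(t,s)\circ\Phi(s,0)$. Let $\rho_R(0)$ be a density operator, let $\rho_R(t)=\Phi(t,0)\rho_R(0)$ for $t\ge 0$, and let $\sigma$ be an invariant state, i.e. a density operator with $\Phi(t,0)\sigma=\sigma$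 for all $t\ge 0$. Then $$D(\rho_R(t)\|\sigma)\le D(\rho_R(s)\|\sigma)\qquad\text{for all } t\ge s\ge 0 .$$ Consequently the backflow functional vanishes, $N_I=0$, for $I(t)=D(\rho_R(t)\|\sigma)$ (with $I(t):=0$ at times where $D(\rho_R(t)\|\sigma)=+\infty$). -/

import Mathlib

open scoped ENNReal ComplexOrder

/-- Linear maps ("superoperators") on the operators of the Hilbert space `ℂⁿ`. -/
abbrev Superop (n : Type*) [Fintype n] := Matrix n n ℂ →ₗ[ℂ] Matrix n n ℂ

/-- Density matrices: positive semidefinite with trace one. -/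
structure IsDensityMatrix {n : Type*} [Fintype n] (ρ : Matrix n n ℂ) : Prop where
  posSemidef : ρ.PosSemidef
  trace_eq_one : ρ.trace = 1

/-- The ampliation `id_k ⊗ Φ`: it applies `Φ` to each `n × n` block of a `k × k` block matrix. -/
def ampliation {n : Type*} [Fintype n] (k : ℕ) (Φ : Superop n)
    (M : Matrix (Fin k × n) (Fin k × n) ℂ) : Matrix (Fin k × n) (Fin k × n) ℂ :=
  Matrix.of fun p q => Φ (Matrix.of fun a b => M (p.1, a) (q.1, b)) p.2 q.2

/-- Completely positive and trace-preserving maps. -/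
structure IsCPTP {n : Type*} [Fintype n] (Φ : Superop n) : Prop where
  completely_positive : ∀ (k : ℕ) (M : Matrix (Fin k × n) (Fin k × n) ℂ),
    M.PosSemidef → (ampliation k Φ M).PosSemidef
  trace_preserving : ∀ X : Matrix n n ℂ, (Φ X).trace = X.trace

/-- CP-divisibility of a family `Φ t = Φ(t,0)`, `t ≥ 0`: for all `t ≥ s ≥ 0` there is a CPTP
map `Λ = Φ(t,s)` with `Φ(t,0) = Φ(t,s) ∘ Φ(s,0)`. -/
def IsCPDivisible {n : Type*} [Fintype n] (Φ : ℝ → Superop n) : Prop :=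
  ∀ s t : ℝ, 0 ≤ s → s ≤ t → ∃ Λ : Superop n, IsCPTP Λ ∧ Φ t = Λ ∘ₗ Φ s

/-- The logarithm of a Hermitian matrix by functional calculus. The value `Real.log 0 = 0` is the
usual convention that the logarithm is taken on the support. -/
noncomputable def matrixLog {n : Type*} [Fintype n] [DecidableEq n] (A : Matrix n n ℂ) :
    Matrix n n ℂ :=
  cfc Real.log A

open Classical in
/-- The quantum relative entropy `D(ρ‖σ) = Tr ρ (log ρ - log σ)` if the support of `ρ` lies in the
support of `σ` (equivalently `ker σ ⊆ ker ρ`), and `+∞` otherwise. -/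
noncomputable def quantumRelEntropy {n : Type*} [Fintype n] [DecidableEq n]
    (ρ σ : Matrix n n ℂ) : EReal :=
  if ∀ v : n → ℂ, σ.mulVec v = 0 → ρ.mulVec v = 0 then
    (((ρ * (matrixLog ρ - matrixLog σ)).trace.re : ℝ) : EReal)
  else ⊤

/-- The Heaviside step function. -/
noncomputable def heavisideStep (x : ℝ) : ℝ := if 0 < x then 1 else 0

/-- The backflow functional `N_I = ∫₀^∞ Θ(I'(t)) I'(t) dt`. The integrand is nonnegative, so the
integral is taken with values in `[0, ∞]`. -/
noncomputable def backflow (I : ℝ → ℝ) : ℝ≥0∞ :=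
  ∫⁻ t in Set.Ioi (0 : ℝ), ENNReal.ofReal (heavisideStep (deriv I t) * deriv I t)

/-!
The heart of the proof is the data processing inequality `D(Λρ‖Λσ) ≤ D(ρ‖σ)` for a completely
positive trace-preserving `Λ` (`IsCPTP.quantumRelEntropy_map_le`). Applied to the propagator
`Λ = Φ(t,s)`, which leaves `σ` invariant, it says that `D(ρ(t)‖σ)` never increases.

Write `L` and `R` for left and right multiplication, and `g_s(ρ,σ) = Tr ρ (s R_ρ + L_σ)⁻¹ ρ`.
From `log x = ∫₀^∞ (1/(1+s) - 1/(s+x)) ds` one gets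
`D(ρ‖σ) = lim_{T → ∞} (∫₀^T g_s(ρ,σ) ds - log T · Tr ρ)`, so it is enough that each `g_s` decreases
under `Λ`. Completing the square gives the variational formula
`g_s(ρ,σ) = sup_X (2 Re Tr Xᴴρ - s Tr XᴴXρ - Tr XXᴴσ)`. Replacing a test operator `X` for
`(Λρ, Λσ)` by `Y = Λ*(X)` for `(ρ, σ)` keeps the linear term and does not increase the quadratic
ones, by the Schwarz inequality `Λ*(X)ᴴ Λ*(X) ≤ Λ*(XᴴX)`, a consequence of complete positivity
with a two-dimensional ancilla (`IsCPTP.exists_resolventFunctional_map_le`).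

In eigenbases `u_i` of `ρ` and `v_j` of `σ`, with eigenvalues `p_i` and `q_j`, `g_s` is the finite
sum `∑ |⟨v_j, u_i⟩|² p_i² / (s p_i + q_j)` (`resolventSum`), so the integrals are elementary.
The same variational formula as `s → 0` shows that `supp ρ ⊆ supp σ` is inherited by the images
(`IsCPTP.ker_le`).

A nonincreasing extended-real quantity has no backflow: its real part, with `⊤` read as `0`, is
locally nonincreasing except at the one instant where the quantity may become finite
(`backflow_toReal_eq_zero`).
-/

open Matrix Filter Topology

/-! ### Schwarz inequality for completely positive maps -/

section Schwarz

variable {n : Type*} [Fintype n]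

/-- Complete positivity at `k = 2`, applied to the positive block matrix with blocks `C_i ρ C_jᴴ`.
For `C = (A, 1)` this is `[[A ρ Aᴴ, A ρ], [ρ Aᴴ, ρ]]`. -/
theorem IsCPTP.posSemidef_block {Λ : Superop n} (hΛ : IsCPTP Λ) {ρ : Matrix n n ℂ}
    (hρ : ρ.PosSemidef) (C : Fin 2 → Matrix n n ℂ) :
    (Matrix.of fun x y : Fin 2 × n => Λ (C x.1 * ρ * (C y.1)ᴴ) x.2 y.2).PosSemidef :=
  hΛ.completely_positive 2 _ (hρ.mul_mul_conjTranspose_same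
    (Matrix.of fun (x : Fin 2 × n) a => C x.1 x.2 a))

variable [DecidableEq n]

theorem IsCPTP.map_mul_conjTranspose {Λ : Superop n} (hΛ : IsCPTP Λ) {ρ : Matrix n n ℂ}
    (hρ : ρ.PosSemidef) (A : Matrix n n ℂ) : Λ (ρ * Aᴴ) = (Λ (A * ρ))ᴴ := by
  have h := (hΛ.posSemidef_block hρ ![A, 1]).isHermitian
  ext a b
  simpa using (h.apply (1, a) (0, b)).symm

theorem IsCPTP.posSemidef_map {Λ : Superop n} (hΛ : IsCPTP Λ) {ρ : Matrix n n ℂ}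
    (hρ : ρ.PosSemidef) : (Λ ρ).PosSemidef := by
  have h := (hΛ.posSemidef_block hρ ![1, 1]).submatrix (fun a : n => ((0 : Fin 2), a))
  convert h
  ext a b
  simp

/-- The Schwarz inequality in dual form: compress the positive block matrix of
`IsCPTP.posSemidef_block` for `C = (A, 1)` by the block row `(1, -B)` and take the trace. -/
theorem IsCPTP.two_mul_re_trace_le {Λ : Superop n} (hΛ : IsCPTP Λ) {ρ : Matrix n n ℂ}
    (hρ : ρ.PosSemidef) (A B : Matrix n n ℂ) :
    2 * (Bᴴ * Λ (A * ρ)).trace.re ≤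
      (Aᴴ * A * ρ).trace.re + (Bᴴ * B * Λ ρ).trace.re := by
  have h := (hΛ.posSemidef_block hρ ![A, 1]).mul_mul_conjTranspose_same
    (Matrix.of fun (a : n) (x : Fin 2 × n) => (![1, -B] : Fin 2 → Matrix n n ℂ) x.1 a x.2)
  have key : (Matrix.of fun (a : n) (x : Fin 2 × n) =>
        (![1, -B] : Fin 2 → Matrix n n ℂ) x.1 a x.2) *
      (Matrix.of fun x y : Fin 2 × n => Λ ((![A, 1] : Fin 2 → Matrix n n ℂ) x.1 * ρ *
        ((![A, 1] : Fin 2 → Matrix n n ℂ) y.1)ᴴ) x.2 y.2) *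
      (Matrix.of fun (a : n) (x : Fin 2 × n) =>
        (![1, -B] : Fin 2 → Matrix n n ℂ) x.1 a x.2)ᴴ =
      Λ (A * ρ * Aᴴ) - Λ (A * ρ) * Bᴴ - B * Λ (ρ * Aᴴ) + B * Λ ρ * Bᴴ := by
    ext a b
    simp [Matrix.mul_apply, Fintype.sum_prod_type, Matrix.one_apply, Finset.sum_add_distrib,
      Finset.sum_mul, add_mul]
    ring
  rw [key] at h
  have h0 := (Complex.le_def.1 h.trace_nonneg).1
  have e1 : (B * (Λ (A * ρ))ᴴ).trace.re = (Bᴴ * Λ (A * ρ)).trace.re := by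
    rw [← Complex.conj_re, ← Complex.star_def, ← trace_conjTranspose, conjTranspose_mul,
      conjTranspose_conjTranspose, trace_mul_comm]
  rw [hΛ.map_mul_conjTranspose hρ] at h0
  simp only [trace_add, trace_sub, hΛ.trace_preserving, Complex.add_re, Complex.sub_re,
    Complex.zero_re, e1] at h0
  rw [trace_mul_comm (Λ (A * ρ)), trace_mul_cycle A, trace_mul_cycle B] at h0
  linarith

/-- Existence of the dual map `Λ*` at `X`, determined by `Tr Λ*(X)ᴴ M = Tr Xᴴ Λ(M)`. -/
theorem exists_trace_dual (Λ : Superop n) (X : Matrix n n ℂ) :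
    ∃ Y : Matrix n n ℂ, ∀ M, (Yᴴ * M).trace = (Xᴴ * Λ M).trace := by
  refine ⟨(Matrix.of fun a b => (Xᴴ * Λ (Matrix.single b a 1)).trace)ᴴ, fun M => ?_⟩
  rw [conjTranspose_conjTranspose]
  conv_rhs => rw [Matrix.matrix_eq_sum_single M]
  simp only [map_sum, Matrix.mul_sum, trace_sum]
  rw [Matrix.trace, Finset.sum_comm]
  refine Finset.sum_congr rfl fun b _ => ?_
  simp only [diag_apply, Matrix.mul_apply, of_apply]
  refine Finset.sum_congr rfl fun a _ => ?_
  have : Matrix.single a b (M a b) = M a b • Matrix.single a b (1 : ℂ) := by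
    simp [Matrix.smul_single]
  rw [this, map_smul, Matrix.mul_smul, trace_smul, smul_eq_mul, mul_comm]

/-- The functional whose supremum over `X` is
`Tr ρ (s R_ρ + L_σ)⁻¹ ρ` for `s > 0`, where `L` and `R` are left and right multiplication. -/
noncomputable def resolventFunctional (s : ℝ) (ρ σ X : Matrix n n ℂ) : ℝ :=
  2 * (Xᴴ * ρ).trace.re - s * (Xᴴ * X * ρ).trace.re - (X * Xᴴ * σ).trace.re

/-- Pulling the test operator back along the dual of `Λ` does not decrease the functional:
the linear term is unchanged, the quadratic terms decrease by the Schwarz inequality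
`Λ*(X)ᴴ Λ*(X) ≤ Λ*(Xᴴ X)`. -/
theorem IsCPTP.exists_resolventFunctional_map_le {Λ : Superop n} (hΛ : IsCPTP Λ)
    {ρ σ : Matrix n n ℂ} (hρ : ρ.PosSemidef) (hσ : σ.PosSemidef) (X : Matrix n n ℂ) :
    ∃ Y : Matrix n n ℂ, ∀ s : ℝ, 0 ≤ s →
      resolventFunctional s (Λ ρ) (Λ σ) X ≤ resolventFunctional s ρ σ Y := by
  obtain ⟨Y, hY⟩ := exists_trace_dual Λ X
  refine ⟨Y, fun s hs => ?_⟩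
  have h1 := hΛ.two_mul_re_trace_le hρ Y X
  rw [← hY, ← Matrix.mul_assoc] at h1
  have h2 := hΛ.two_mul_re_trace_le hσ Yᴴ Xᴴ
  have e2 : (X * Λ (Yᴴ * σ)).trace.re = (Y * Yᴴ * σ).trace.re := by
    have h := hΛ.map_mul_conjTranspose hσ Yᴴ
    rw [conjTranspose_conjTranspose] at h
    have : Λ (Yᴴ * σ) = (Λ (σ * Y))ᴴ := by rw [h, conjTranspose_conjTranspose]
    rw [this, ← Complex.conj_re, ← Complex.star_def, ← trace_conjTranspose, conjTranspose_mul,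
      conjTranspose_conjTranspose, trace_mul_comm, ← hY, ← Matrix.mul_assoc, trace_mul_comm,
      ← Matrix.mul_assoc]
  simp only [conjTranspose_conjTranspose, e2] at h2
  unfold resolventFunctional
  rw [hY ρ]
  nlinarith

end Schwarz

/-! ### Spectral coordinates -/

section Spectral

variable {n : Type*} [Fintype n] [DecidableEq n]

/-- The operator with real eigenvalues `a` and the columns of `U` as eigenvectors. -/
noncomputable def ofSpectrum (U : Matrix.unitaryGroup n ℂ) (a : n → ℝ) : Matrix n n ℂ :=
  (U : Matrix n n ℂ) * diagonal (fun i => (a i : ℂ)) * (U : Matrix n n ℂ)ᴴ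

theorem Matrix.PosSemidef.exists_ofSpectrum {ρ : Matrix n n ℂ} (hρ : ρ.PosSemidef) :
    ∃ (U : Matrix.unitaryGroup n ℂ) (p : n → ℝ), (∀ i, 0 ≤ p i) ∧ ρ = ofSpectrum U p ∧
      matrixLog ρ = ofSpectrum U fun i => Real.log (p i) := by
  refine ⟨hρ.isHermitian.eigenvectorUnitary, hρ.isHermitian.eigenvalues, hρ.eigenvalues_nonneg,
    ?_, ?_⟩
  · conv_lhs => rw [hρ.isHermitian.spectral_theorem]
    rfl
  · rw [matrixLog, hρ.isHermitian.cfc_eq]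
    rfl

/-- The transition probabilities `|⟨v_j, u_i⟩|²` between two orthonormal bases. -/
noncomputable def overlap (U V : Matrix.unitaryGroup n ℂ) (j i : n) : ℝ :=
  Complex.normSq (((V : Matrix n n ℂ)ᴴ * U) j i)

theorem overlap_nonneg (U V : Matrix.unitaryGroup n ℂ) (j i : n) : 0 ≤ overlap U V j i :=
  Complex.normSq_nonneg _

theorem conjTranspose_mul_coe (U : Matrix.unitaryGroup n ℂ) :
    (U : Matrix n n ℂ)ᴴ * (U : Matrix n n ℂ) = 1 := Unitary.coe_star_mul_self U

theorem coe_mul_conjTranspose (U : Matrix.unitaryGroup n ℂ) :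
    (U : Matrix n n ℂ) * (U : Matrix n n ℂ)ᴴ = 1 := Unitary.coe_mul_star_self U

theorem ofSpectrum_mul (U : Matrix.unitaryGroup n ℂ) (a b : n → ℝ) :
    ofSpectrum U a * ofSpectrum U b = ofSpectrum U fun i => a i * b i := by
  have h : ofSpectrum U a * ofSpectrum U b = (U : Matrix n n ℂ) * diagonal (fun i => (a i : ℂ)) *
      ((U : Matrix n n ℂ)ᴴ * (U : Matrix n n ℂ)) * diagonal (fun i => (b i : ℂ)) *
      (U : Matrix n n ℂ)ᴴ := by
    simp only [ofSpectrum, Matrix.mul_assoc]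
  rw [h, conjTranspose_mul_coe, Matrix.mul_one, Matrix.mul_assoc (U : Matrix n n ℂ),
    diagonal_mul_diagonal]
  simp [ofSpectrum]

theorem ofSpectrum_one (U : Matrix.unitaryGroup n ℂ) : ofSpectrum U (fun _ => 1) = 1 := by
  simp [ofSpectrum, coe_mul_conjTranspose]

theorem trace_conjTranspose_mul_diagonal (Z W : Matrix n n ℂ) (a b : n → ℝ) :
    (Zᴴ * diagonal (fun j => (b j : ℂ)) * W * diagonal (fun i => (a i : ℂ))).trace.re =
      ∑ i, ∑ j, (star (Z j i) * W j i).re * a i * b j := by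
  simp only [Matrix.trace, diag_apply, mul_diagonal, Matrix.mul_apply (N := W), mul_diagonal,
    conjTranspose_apply, Finset.sum_mul, Complex.re_sum]
  refine Finset.sum_congr rfl fun i _ => Finset.sum_congr rfl fun j _ => ?_
  rw [show star (Z j i) * (b j : ℂ) * W j i * (a i : ℂ) =
    ((a i * b j : ℝ) : ℂ) * (star (Z j i) * W j i) by push_cast; ring, Complex.re_ofReal_mul]
  ring

/-- The weighted pairing of `X` and `Y` in their matrix coordinates `Vᴴ X U` and `Vᴴ Y U`. -/
theorem trace_conjTranspose_mul_ofSpectrum (U V : Matrix.unitaryGroup n ℂ) (a b : n → ℝ)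
    (X Y : Matrix n n ℂ) :
    (Xᴴ * ofSpectrum V b * Y * ofSpectrum U a).trace.re =
      ∑ i, ∑ j, (star (((V : Matrix n n ℂ)ᴴ * X * U) j i) *
        ((V : Matrix n n ℂ)ᴴ * Y * U) j i).re * a i * b j := by
  rw [← trace_conjTranspose_mul_diagonal]
  congr 1
  simp only [ofSpectrum, conjTranspose_mul, conjTranspose_conjTranspose]
  rw [← Matrix.mul_assoc, trace_mul_comm]
  simp only [Matrix.mul_assoc]

theorem trace_ofSpectrum_mul (U V : Matrix.unitaryGroup n ℂ) (a b : n → ℝ) :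
    (ofSpectrum U a * ofSpectrum V b).trace.re = ∑ i, ∑ j, overlap U V j i * a i * b j := by
  have h := trace_conjTranspose_mul_ofSpectrum U V a b 1 1
  simp only [conjTranspose_one, Matrix.one_mul, Matrix.mul_one] at h
  rw [trace_mul_comm, h]
  refine Finset.sum_congr rfl fun i _ => Finset.sum_congr rfl fun j _ => ?_
  simp [overlap, Complex.normSq_apply]

theorem trace_ofSpectrum (U V : Matrix.unitaryGroup n ℂ) (a : n → ℝ) :
    (ofSpectrum U a).trace.re = ∑ i, ∑ j, overlap U V j i * a i := by
  simpa [ofSpectrum_one] using trace_ofSpectrum_mul U V a fun _ => 1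

theorem resolventFunctional_ofSpectrum (U V : Matrix.unitaryGroup n ℂ) (p q : n → ℝ) (s : ℝ)
    (X : Matrix n n ℂ) :
    resolventFunctional s (ofSpectrum U p) (ofSpectrum V q) X =
      ∑ i, ∑ j, (2 * (star (((V : Matrix n n ℂ)ᴴ * X * U) j i) *
          ((V : Matrix n n ℂ)ᴴ * (U : Matrix n n ℂ)) j i).re * p i -
        (s * p i + q j) * Complex.normSq (((V : Matrix n n ℂ)ᴴ * X * U) j i)) := by
  have h1 := trace_conjTranspose_mul_ofSpectrum U V p (fun _ => 1) X 1
  have h2 := trace_conjTranspose_mul_ofSpectrum U V p (fun _ => 1) X X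
  have h3 := trace_conjTranspose_mul_ofSpectrum U V (fun _ => 1) q X X
  simp only [ofSpectrum_one, mul_one] at h1 h2 h3
  rw [resolventFunctional, h1, h2, Matrix.mul_assoc X, trace_mul_comm X, h3, Finset.mul_sum,
    Finset.mul_sum, ← Finset.sum_sub_distrib, ← Finset.sum_sub_distrib]
  refine Finset.sum_congr rfl fun i _ => ?_
  rw [Finset.mul_sum, Finset.mul_sum, ← Finset.sum_sub_distrib, ← Finset.sum_sub_distrib]
  refine Finset.sum_congr rfl fun j _ => ?_
  simp [Complex.normSq_apply]
  ring

/-- The supremum of `resolventFunctional s ρ σ` in spectral coordinates of `ρ` and `σ`. -/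
noncomputable def resolventSum (U V : Matrix.unitaryGroup n ℂ) (p q : n → ℝ) (s : ℝ) : ℝ :=
  ∑ i, ∑ j, overlap U V j i * (p i ^ 2 / (s * p i + q j))

theorem two_mul_re_mul_sub_le (z u : ℂ) {p q s : ℝ} (hp : 0 ≤ p) (hq : 0 ≤ q) (hs : 0 < s) :
    2 * (star z * u).re * p - (s * p + q) * Complex.normSq z ≤
      Complex.normSq u * (p ^ 2 / (s * p + q)) := by
  have hsp : 0 ≤ s * p := by positivity
  rcases (add_nonneg hsp hq).eq_or_lt with h | h
  · have : p = 0 := by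
      rcases mul_eq_zero.1 (by linarith : s * p = 0) with h' | h'
      · exact absurd h' hs.ne'
      · exact h'
    simp [this]
    exact mul_nonneg hq (Complex.normSq_nonneg z)
  · rw [← mul_div_assoc, le_div_iff₀ h]
    -- the difference of the two sides is `|u p - (s p + q) z|²`
    have := Complex.normSq_nonneg (u * p - (s * p + q : ℝ) * z)
    simp only [Complex.normSq_apply, Complex.sub_re, Complex.mul_re, Complex.sub_im,
      Complex.mul_im, Complex.ofReal_re, Complex.ofReal_im, Complex.star_def, Complex.conj_re,
      Complex.conj_im] at this ⊢
    nlinarith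

theorem resolventFunctional_le_resolventSum (U V : Matrix.unitaryGroup n ℂ) {p q : n → ℝ}
    (hp : ∀ i, 0 ≤ p i) (hq : ∀ j, 0 ≤ q j) {s : ℝ} (hs : 0 < s) (X : Matrix n n ℂ) :
    resolventFunctional s (ofSpectrum U p) (ofSpectrum V q) X ≤ resolventSum U V p q s := by
  rw [resolventFunctional_ofSpectrum]
  exact Finset.sum_le_sum fun i _ => Finset.sum_le_sum fun j _ =>
    two_mul_re_mul_sub_le _ _ (hp i) (hq j) hs

theorem exists_resolventFunctional_eq_resolventSum (U V : Matrix.unitaryGroup n ℂ) (p q : n → ℝ)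
    (s : ℝ) :
    ∃ X, resolventFunctional s (ofSpectrum U p) (ofSpectrum V q) X = resolventSum U V p q s := by
  let W : Matrix n n ℂ := (V : Matrix n n ℂ)ᴴ * (U : Matrix n n ℂ)
  let Z : Matrix n n ℂ := Matrix.of fun j i => ((p i / (s * p i + q j) : ℝ) : ℂ) * W j i
  refine ⟨V * Z * (U : Matrix n n ℂ)ᴴ, ?_⟩
  have hZ : (V : Matrix n n ℂ)ᴴ * (V * Z * (U : Matrix n n ℂ)ᴴ) * U = Z := by
    rw [show (V : Matrix n n ℂ)ᴴ * (V * Z * (U : Matrix n n ℂ)ᴴ) * U =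
      ((V : Matrix n n ℂ)ᴴ * V) * Z * ((U : Matrix n n ℂ)ᴴ * U) by
        simp only [Matrix.mul_assoc], conjTranspose_mul_coe, conjTranspose_mul_coe]
    simp
  rw [resolventFunctional_ofSpectrum, hZ, resolventSum]
  refine Finset.sum_congr rfl fun i _ => Finset.sum_congr rfl fun j _ => ?_
  have hZji : Z j i = ((p i / (s * p i + q j) : ℝ) : ℂ) * W j i := rfl
  change 2 * (star (Z j i) * W j i).re * p i - (s * p i + q j) * Complex.normSq (Z j i) =
    Complex.normSq (W j i) * _
  rw [hZji]
  generalize s * p i + q j = d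
  -- for `d = 0` both sides vanish, since division by zero gives zero
  rcases eq_or_ne d 0 with h | h
  · simp [h]
  · simp only [Complex.normSq_apply, Complex.mul_re,
      Complex.mul_im, Complex.ofReal_re, Complex.ofReal_im, Complex.star_def, Complex.conj_re,
      Complex.conj_im]
    field_simp
    ring

/-- If `ker σ ⊆ ker ρ`, eigenvectors of `ρ` with nonzero eigenvalue are orthogonal to `ker σ`. -/
theorem overlap_mul_eq_zero {U V : Matrix.unitaryGroup n ℂ} {p q : n → ℝ}
    (hker : ∀ v : n → ℂ, (ofSpectrum V q).mulVec v = 0 → (ofSpectrum U p).mulVec v = 0)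
    {j : n} (hj : q j = 0) (i : n) : overlap U V j i * p i = 0 := by
  have h0 : ofSpectrum V q *ᵥ ((V : Matrix n n ℂ) *ᵥ Pi.single j 1) = 0 := by
    rw [mulVec_mulVec, ofSpectrum, Matrix.mul_assoc, conjTranspose_mul_coe, Matrix.mul_one,
      ← mulVec_mulVec]
    have hd : diagonal (fun k => (q k : ℂ)) *ᵥ Pi.single j 1 = 0 := by
      ext k
      rcases eq_or_ne k j with rfl | hk
      · simp [mulVec_diagonal, hj]
      · simp [mulVec_diagonal, hk]
    rw [hd, mulVec_zero]
  have h1 := hker _ h0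
  have h2 : (U : Matrix n n ℂ)ᴴ *ᵥ
      (ofSpectrum U p *ᵥ ((V : Matrix n n ℂ) *ᵥ Pi.single j 1)) = 0 := by
    rw [h1, mulVec_zero]
  rw [ofSpectrum, mulVec_mulVec, mulVec_mulVec, ← Matrix.mul_assoc, ← Matrix.mul_assoc,
    conjTranspose_mul_coe, Matrix.one_mul, Matrix.mul_assoc] at h2
  have h3 := congrFun h2 i
  rw [← mulVec_mulVec, mulVec_diagonal, mulVec_single_one, Pi.zero_apply, col_apply,
    mul_eq_zero] at h3
  rcases h3 with h3 | h3
  · simp [Complex.ofReal_eq_zero.1 h3]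
  · have : ((V : Matrix n n ℂ)ᴴ * (U : Matrix n n ℂ)) j i =
        star (((U : Matrix n n ℂ)ᴴ * (V : Matrix n n ℂ)) i j) := by
      rw [← conjTranspose_apply, conjTranspose_mul, conjTranspose_conjTranspose]
    simp [overlap, this, h3]

theorem resolventSum_le_sum_div {U V : Matrix.unitaryGroup n ℂ} {p q : n → ℝ} (hp : ∀ i, 0 ≤ p i)
    (hq : ∀ j, 0 ≤ q j)
    (hsupp : ∀ i j, q j = 0 → overlap U V j i * p i = 0) {s : ℝ} (hs : 0 < s) :
    resolventSum U V p q s ≤ ∑ i, ∑ j, overlap U V j i * (p i ^ 2 / q j) := by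
  refine Finset.sum_le_sum fun i _ => Finset.sum_le_sum fun j _ => ?_
  have hsp := mul_nonneg hs.le (hp i)
  rcases (hq j).eq_or_lt with h | h
  · have := hsupp i j h.symm
    rcases mul_eq_zero.1 this with h' | h' <;> simp [h']
  · refine mul_le_mul_of_nonneg_left ?_ (overlap_nonneg _ _ _ _)
    exact div_le_div_of_nonneg_left (sq_nonneg _) h (by linarith)

end Spectral

/-! ### Integral representation of the relative entropy -/

section Integral

theorem continuousOn_sq_div_mul_add {p q T : ℝ} (hp : 0 ≤ p) (hq : 0 < q) (hT : 0 ≤ T) :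
    ContinuousOn (fun s => p ^ 2 / (s * p + q)) (Set.uIcc 0 T) := by
  refine ContinuousOn.div (by fun_prop) (by fun_prop) fun s hs => ?_
  rw [Set.uIcc_of_le hT] at hs
  have := mul_nonneg hs.1 hp
  positivity

theorem integral_sq_div_mul_add {p q T : ℝ} (hp : 0 ≤ p) (hq : 0 < q) (hT : 0 ≤ T) :
    ∫ s in (0 : ℝ)..T, p ^ 2 / (s * p + q) = p * Real.log (T * p + q) - p * Real.log q := by
  rw [intervalIntegral.integral_eq_sub_of_hasDerivAt (f := fun s => p * Real.log (s * p + q))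
    _ (continuousOn_sq_div_mul_add hp hq hT).intervalIntegrable]
  · simp
  · intro s hs
    rw [Set.uIcc_of_le hT] at hs
    have h0 : 0 < s * p + q := by
      have := mul_nonneg hs.1 hp
      positivity
    have h := ((((hasDerivAt_id' s).mul_const p).add_const q).log h0.ne').const_mul p
    rwa [one_mul, ← mul_div_assoc, ← sq] at h

theorem tendsto_log_mul_add_sub_log {p q : ℝ} (hp : 0 < p) :
    Tendsto (fun T : ℝ => Real.log (T * p + q) - Real.log T) atTop (𝓝 (Real.log p)) := by
  have h : Tendsto (fun T : ℝ => p + q / T) atTop (𝓝 p) := by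
    simpa using tendsto_const_nhds.add ((tendsto_const_nhds (x := q)).div_atTop tendsto_id)
  refine (h.log hp.ne').congr' ?_
  filter_upwards [eventually_gt_atTop 0, h.eventually_ne hp.ne'] with T hT hne
  have : T * p + q = T * (p + q / T) := by field_simp
  rw [this, Real.log_mul hT.ne' hne]
  ring

variable {n : Type*} [Fintype n] [DecidableEq n]

theorem intervalIntegrable_overlap_mul {U V : Matrix.unitaryGroup n ℂ} {p q : n → ℝ}
    (hp : ∀ i, 0 ≤ p i) (hq : ∀ j, 0 ≤ q j)
    (hsupp : ∀ i j, q j = 0 → overlap U V j i * p i = 0) {T : ℝ} (hT : 0 ≤ T) (i j : n) :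
    IntervalIntegrable (fun s => overlap U V j i * (p i ^ 2 / (s * p i + q j)))
      MeasureTheory.volume 0 T := by
  rcases (hq j).eq_or_lt with h | h
  · rcases mul_eq_zero.1 (hsupp i j h.symm) with h' | h' <;> simp [h']
  · exact (continuousOn_sq_div_mul_add (hp i) h hT).intervalIntegrable.const_mul _

theorem intervalIntegrable_resolventSum {U V : Matrix.unitaryGroup n ℂ} {p q : n → ℝ}
    (hp : ∀ i, 0 ≤ p i) (hq : ∀ j, 0 ≤ q j)
    (hsupp : ∀ i j, q j = 0 → overlap U V j i * p i = 0) {T : ℝ} (hT : 0 ≤ T) :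
    IntervalIntegrable (resolventSum U V p q) MeasureTheory.volume 0 T := by
  have h := IntervalIntegrable.sum Finset.univ fun i _ => IntervalIntegrable.sum Finset.univ
    fun j _ => intervalIntegrable_overlap_mul hp hq hsupp hT i j
  simpa only [Finset.sum_fn] using! h

theorem integral_resolventSum {U V : Matrix.unitaryGroup n ℂ} {p q : n → ℝ}
    (hp : ∀ i, 0 ≤ p i) (hq : ∀ j, 0 ≤ q j)
    (hsupp : ∀ i j, q j = 0 → overlap U V j i * p i = 0) {T : ℝ} (hT : 0 ≤ T) :
    ∫ s in (0 : ℝ)..T, resolventSum U V p q s =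
      ∑ i, ∑ j, overlap U V j i * (p i * Real.log (T * p i + q j) - p i * Real.log (q j)) := by
  have hint := intervalIntegrable_overlap_mul hp hq hsupp hT
  simp only [resolventSum]
  rw [intervalIntegral.integral_finsetSum fun i _ => by
    simpa [Finset.sum_fn] using IntervalIntegrable.sum Finset.univ fun j _ => hint i j]
  refine Finset.sum_congr rfl fun i _ => ?_
  rw [intervalIntegral.integral_finsetSum fun j _ => hint i j]
  refine Finset.sum_congr rfl fun j _ => ?_
  rcases (hq j).eq_or_lt with h | h
  · rcases mul_eq_zero.1 (hsupp i j h.symm) with h' | h' <;> simp [h']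
  · rw [intervalIntegral.integral_const_mul, integral_sq_div_mul_add (hp i) h hT]

theorem trace_mul_log_sub_log (U V : Matrix.unitaryGroup n ℂ) (p q : n → ℝ) :
    (ofSpectrum U p * ((ofSpectrum U fun i => Real.log (p i)) -
      ofSpectrum V fun j => Real.log (q j))).trace.re =
      ∑ i, ∑ j, overlap U V j i * (p i * Real.log (p i) - p i * Real.log (q j)) := by
  rw [Matrix.mul_sub, trace_sub, Complex.sub_re, ofSpectrum_mul, trace_ofSpectrum U V,
    trace_ofSpectrum_mul]
  simp only [← Finset.sum_sub_distrib]
  refine Finset.sum_congr rfl fun i _ => Finset.sum_congr rfl fun j _ => ?_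
  ring

/-- The relative entropy is the integral of the resolvent sums over `s ∈ (0, ∞)`, with the
logarithmic divergence `log T · Tr ρ` removed. -/
theorem tendsto_integral_resolventSum {U V : Matrix.unitaryGroup n ℂ} {p q : n → ℝ}
    (hp : ∀ i, 0 ≤ p i) (hq : ∀ j, 0 ≤ q j)
    (hsupp : ∀ i j, q j = 0 → overlap U V j i * p i = 0) :
    Tendsto (fun T : ℝ => (∫ s in (0 : ℝ)..T, resolventSum U V p q s) -
        Real.log T * (ofSpectrum U p).trace.re) atTop
      (𝓝 (ofSpectrum U p * ((ofSpectrum U fun i => Real.log (p i)) -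
        ofSpectrum V fun j => Real.log (q j))).trace.re) := by
  rw [trace_mul_log_sub_log]
  have h : Tendsto (fun T : ℝ => ∑ i, ∑ j, overlap U V j i *
      (p i * (Real.log (T * p i + q j) - Real.log T) - p i * Real.log (q j))) atTop
      (𝓝 (∑ i, ∑ j, overlap U V j i * (p i * Real.log (p i) - p i * Real.log (q j)))) := by
    refine tendsto_finsetSum _ fun i _ => tendsto_finsetSum _ fun j _ => ?_
    rcases (hp i).eq_or_lt with h' | h'
    · simp [← h']
    · exact (((tendsto_log_mul_add_sub_log h').const_mul _).sub_const _).const_mul _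
  refine h.congr' ?_
  filter_upwards [eventually_ge_atTop 0] with T hT
  rw [integral_resolventSum hp hq hsupp hT, trace_ofSpectrum U V, Finset.mul_sum,
    ← Finset.sum_sub_distrib]
  refine Finset.sum_congr rfl fun i _ => ?_
  rw [Finset.mul_sum, ← Finset.sum_sub_distrib]
  refine Finset.sum_congr rfl fun j _ => ?_
  ring

end Integral

/-! ### Data processing inequality -/

section DataProcessing

variable {n : Type*} [Fintype n] [DecidableEq n]

theorem IsCPTP.resolventSum_le {Λ : Superop n} (hΛ : IsCPTP Λ)
    {U V U' V' : Matrix.unitaryGroup n ℂ} {p q p' q' : n → ℝ}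
    (hp : ∀ i, 0 ≤ p i) (hq : ∀ j, 0 ≤ q j)
    (hρ : (ofSpectrum U p).PosSemidef) (hσ : (ofSpectrum V q).PosSemidef)
    (hρ' : Λ (ofSpectrum U p) = ofSpectrum U' p') (hσ' : Λ (ofSpectrum V q) = ofSpectrum V' q')
    {s : ℝ} (hs : 0 < s) : resolventSum U' V' p' q' s ≤ resolventSum U V p q s := by
  obtain ⟨X, hX⟩ := exists_resolventFunctional_eq_resolventSum U' V' p' q' s
  obtain ⟨Y, hY⟩ := hΛ.exists_resolventFunctional_map_le hρ hσ X
  rw [← hX, ← hρ', ← hσ']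
  exact (hY s hs.le).trans (resolventFunctional_le_resolventSum U V hp hq hs Y)

/-- A completely positive trace-preserving map preserves the inclusion of supports. If `v` is in
the kernel of `Λ σ` then the functional at `X = c v vᴴ` has no `σ` term, while its supremum stays
bounded as `s → 0`; letting `c` be large then forces `⟨v, Λ ρ v⟩ = 0`. -/
theorem IsCPTP.ker_le {Λ : Superop n} (hΛ : IsCPTP Λ) {ρ σ : Matrix n n ℂ}
    (hρ : ρ.PosSemidef) (hσ : σ.PosSemidef)
    (hker : ∀ v : n → ℂ, σ.mulVec v = 0 → ρ.mulVec v = 0) (v : n → ℂ)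
    (hv : (Λ σ).mulVec v = 0) : (Λ ρ).mulVec v = 0 := by
  have hρ' := hΛ.posSemidef_map hρ
  rw [← hρ'.dotProduct_mulVec_zero_iff]
  obtain ⟨U, p, hp, hρU, -⟩ := hρ.exists_ofSpectrum
  obtain ⟨V, q, hq, hσV, -⟩ := hσ.exists_ofSpectrum
  have hsupp : ∀ i j, q j = 0 → overlap U V j i * p i = 0 := fun i j hj =>
    overlap_mul_eq_zero (hρU ▸ hσV ▸ hker) hj i
  set C := ∑ i, ∑ j, overlap U V j i * (p i ^ 2 / q j)
  set r := (star v ⬝ᵥ Λ ρ *ᵥ v).re with hr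
  set m := (star v ⬝ᵥ v).re with hm
  have him : (star v ⬝ᵥ v).im = 0 := (Complex.le_def.1 (dotProduct_star_self_nonneg v)).2.symm
  have hr0 : 0 ≤ r := (Complex.le_def.1 (hρ'.dotProduct_mulVec_nonneg v)).1
  have hrim : (star v ⬝ᵥ Λ ρ *ᵥ v).im = 0 :=
    (Complex.le_def.1 (hρ'.dotProduct_mulVec_nonneg v)).2.symm
  have hbound (c s : ℝ) (hs : 0 < s) : 2 * c * r - s * (c ^ 2 * m * r) ≤ C := by
    obtain ⟨Y, hY⟩ := hΛ.exists_resolventFunctional_map_le hρ hσ ((c : ℂ) • vecMulVec v (star v))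
    have h1 := hY s hs.le
    rw [hρU, hσV] at h1
    have h2 := h1.trans ((resolventFunctional_le_resolventSum U V hp hq hs Y).trans
      (resolventSum_le_sum_div hp hq hsupp hs))
    rw [← hρU, ← hσV] at h2
    refine le_of_eq_of_le ?_ h2
    have hX : ((c : ℂ) • vecMulVec v (star v))ᴴ = (c : ℂ) • vecMulVec v (star v) := by
      simp [conjTranspose_smul, conjTranspose_vecMulVec]
    have t1 : (vecMulVec v (star v) * Λ ρ).trace = star v ⬝ᵥ Λ ρ *ᵥ v := by
      rw [vecMulVec_mul, trace_vecMulVec, dotProduct_comm, dotProduct_mulVec]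
    have t2 : (vecMulVec v (star v) * Λ σ).trace = 0 := by
      rw [vecMulVec_mul, trace_vecMulVec, dotProduct_comm, ← dotProduct_mulVec, hv,
        dotProduct_zero]
    have t3 : vecMulVec v (star v) * vecMulVec v (star v) =
        (star v ⬝ᵥ v) • vecMulVec v (star v) := by
      rw [vecMulVec_mul_vecMulVec, vecMulVec_smul]
    rw [resolventFunctional, hX]
    simp only [Matrix.smul_mul, Matrix.mul_smul, trace_smul, t1, t2, t3, smul_eq_mul,
      Complex.mul_re, Complex.mul_im, Complex.ofReal_re, Complex.ofReal_im, Complex.zero_re,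
      Complex.zero_im, him, hrim, ← hr, ← hm]
    ring
  have hlin (c : ℝ) : 2 * c * r ≤ C := by
    have hlim : Tendsto (fun s : ℝ => 2 * c * r - s * (c ^ 2 * m * r)) (𝓝[>] 0)
        (𝓝 (2 * c * r)) := by
      have : Tendsto (fun s : ℝ => 2 * c * r - s * (c ^ 2 * m * r)) (𝓝 0)
          (𝓝 (2 * c * r - 0 * (c ^ 2 * m * r))) := by
        exact (Continuous.tendsto (by fun_prop) 0)
      simpa using this.mono_left nhdsWithin_le_nhds
    exact le_of_tendsto hlim (eventually_nhdsWithin_of_forall fun s hs => hbound c s hs)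
  have hrz : r = 0 := by
    by_contra hne
    have hpos : 0 < r := lt_of_le_of_ne hr0 (Ne.symm hne)
    have := hlin ((C + 1) / r)
    have e : 2 * ((C + 1) / r) * r = 2 * (C + 1) := by field_simp
    have h0 := hlin 0
    rw [e] at this
    simp only [mul_zero, zero_mul] at h0
    linarith
  exact Complex.ext hrz hrim

/-- The data processing inequality: the resolvent sums decrease for every `s > 0`, and the divergent
term `log T · Tr ρ` is the same on both sides because `Λ` preserves the trace. -/
theorem IsCPTP.quantumRelEntropy_map_le {Λ : Superop n} (hΛ : IsCPTP Λ) {ρ σ : Matrix n n ℂ}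
    (hρ : ρ.PosSemidef) (hσ : σ.PosSemidef) :
    quantumRelEntropy (Λ ρ) (Λ σ) ≤ quantumRelEntropy ρ σ := by
  by_cases hker : ∀ v : n → ℂ, σ.mulVec v = 0 → ρ.mulVec v = 0
  · have hker' := hΛ.ker_le hρ hσ hker
    rw [quantumRelEntropy, quantumRelEntropy, if_pos hker, if_pos hker', EReal.coe_le_coe_iff]
    have htr := hΛ.trace_preserving ρ
    obtain ⟨U', p', hp', hρU', hlogρ'⟩ := (hΛ.posSemidef_map hρ).exists_ofSpectrum
    obtain ⟨V', q', hq', hσV', hlogσ'⟩ := (hΛ.posSemidef_map hσ).exists_ofSpectrum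
    obtain ⟨U, p, hp, hρU, hlogρ⟩ := hρ.exists_ofSpectrum
    obtain ⟨V, q, hq, hσV, hlogσ⟩ := hσ.exists_ofSpectrum
    rw [hlogρ, hlogσ, hlogρ', hlogσ', hρU']
    rw [hρU', hσV'] at hker'
    rw [hρU'] at htr
    subst hρU hσV
    have hsupp : ∀ i j, q j = 0 → overlap U V j i * p i = 0 := fun i j hj =>
      overlap_mul_eq_zero hker hj i
    have hsupp' : ∀ i j, q' j = 0 → overlap U' V' j i * p' i = 0 := fun i j hj =>
      overlap_mul_eq_zero hker' hj i
    refine le_of_tendsto_of_tendsto (tendsto_integral_resolventSum hp' hq' hsupp')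
      (tendsto_integral_resolventSum hp hq hsupp) ?_
    filter_upwards [eventually_ge_atTop 0] with T hT
    rw [htr]
    refine sub_le_sub_right (intervalIntegral.integral_mono_on_of_le_Ioo hT
      (intervalIntegrable_resolventSum hp' hq' hsupp' hT)
      (intervalIntegrable_resolventSum hp hq hsupp hT) fun s hs => ?_) _
    exact hΛ.resolventSum_le hp hq hρ hσ hρU' hσV' hs.1
  · rw [quantumRelEntropy.eq_def ρ σ, if_neg hker]
    exact le_top

theorem quantumRelEntropy_ne_bot (ρ σ : Matrix n n ℂ) : quantumRelEntropy ρ σ ≠ ⊥ := by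
  rw [quantumRelEntropy]
  split_ifs
  · exact EReal.coe_ne_bot _
  · exact top_ne_bot

end DataProcessing

/-! ### Vanishing backflow of nonincreasing quantities -/

/-- An extended-real quantity that never increases has no backflow. Its real part can only grow
at the single instant at which the quantity drops from `⊤` to finite values. -/
theorem backflow_toReal_eq_zero {D : ℝ → EReal} (hbot : ∀ t, D t ≠ ⊥)
    (hD : AntitoneOn D (Set.Ici 0)) : backflow (fun t => (D t).toReal) = 0 := by
  set I : ℝ → ℝ := fun t => (D t).toReal with hI
  set S : Set ℝ := {t | 0 < t ∧ 0 < deriv I t} with hS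
  have before {t : ℝ} (ht : t ∈ S) {u : ℝ} (hu : 0 ≤ u) (hut : u < t) : D u = ⊤ := by
    by_contra hfin
    have hanti : AntitoneOn I (Set.Ici u) := fun x hx y hy hxy =>
      EReal.toReal_le_toReal (hD (hu.trans hx) (hu.trans hy) hxy) (hbot y)
        (ne_top_of_le_ne_top hfin (hD hu (hu.trans hx) hx))
    have := hanti.derivWithin_nonpos (x := t)
    rw [derivWithin_of_mem_nhds (Ici_mem_nhds hut)] at this
    exact absurd ht.2 this.not_gt
  have after {t : ℝ} (ht : t ∈ S) {u : ℝ} (hut : t < u) : D u ≠ ⊤ := by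
    intro htop
    have hzero : I =ᶠ[𝓝 t] fun _ => 0 := by
      filter_upwards [Ioo_mem_nhds ht.1 hut] with x hx
      have : D x = ⊤ := top_le_iff.1 (htop ▸ hD hx.1.le (ht.1.trans hut).le hx.2.le)
      simp [hI, this]
    have := hzero.deriv_eq
    rw [deriv_const] at this
    exact absurd ht.2 this.not_gt
  have hsub : S.Subsingleton := by
    have aux {t u : ℝ} (ht : t ∈ S) (hu : u ∈ S) : ¬ t < u := fun htu =>
      after ht (left_lt_add_div_two.2 htu)
        (before hu (by have := ht.1; have := hu.1; positivity) (add_div_two_lt_right.2 htu))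
    exact fun t ht u hu => le_antisymm (not_lt.1 (aux hu ht)) (not_lt.1 (aux ht hu))
  rw [backflow, MeasureTheory.lintegral_congr_ae (g := fun _ => 0), MeasureTheory.lintegral_zero]
  rw [Filter.EventuallyEq, MeasureTheory.ae_restrict_iff' measurableSet_Ioi]
  filter_upwards [hsub.countable.ae_notMem MeasureTheory.volume] with t ht ht0
  have : ¬ 0 < deriv I t := fun h => ht ⟨ht0, h⟩
  simp [heavisideStep, this]

theorem theorem1 {n : Type*} [Fintype n] [DecidableEq n]
    (Φ : ℝ → Superop n) (ρ : ℝ → Matrix n n ℂ) (σ : Matrix n n ℂ)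
    (hCPTP : ∀ t : ℝ, 0 ≤ t → IsCPTP (Φ t))
    (hdiv : IsCPDivisible Φ)
    (hρ0 : IsDensityMatrix (ρ 0))
    (hρ : ∀ t : ℝ, 0 ≤ t → ρ t = Φ t (ρ 0))
    (hσ : IsDensityMatrix σ)
    (hinv : ∀ t : ℝ, 0 ≤ t → Φ t σ = σ) :
    (∀ s t : ℝ, 0 ≤ s → s ≤ t →
      quantumRelEntropy (ρ t) σ ≤ quantumRelEntropy (ρ s) σ) ∧
    backflow (fun t => (quantumRelEntropy (ρ t) σ).toReal) = 0 := by
  have hmono : ∀ s t : ℝ, 0 ≤ s → s ≤ t →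
      quantumRelEntropy (ρ t) σ ≤ quantumRelEntropy (ρ s) σ := by
    intro s t hs hst
    obtain ⟨Λ, hΛ, hcomp⟩ := hdiv s t hs hst
    have hρt : ρ t = Λ (ρ s) := by
      rw [hρ t (hs.trans hst), hcomp, LinearMap.comp_apply, ← hρ s hs]
    -- the propagator from `s` to `t` also leaves `σ` invariant
    have hσt : Λ σ = σ := by
      have h := hinv t (hs.trans hst)
      rwa [hcomp, LinearMap.comp_apply, hinv s hs] at h
    have hρs : (ρ s).PosSemidef := by
      rw [hρ s hs]
      exact (hCPTP s hs).posSemidef_map hρ0.posSemidef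
    simpa only [← hρt, hσt] using hΛ.quantumRelEntropy_map_le hρs hσ.posSemidef
  exact ⟨hmono, backflow_toReal_eq_zero (fun t => quantumRelEntropy_ne_bot _ _)
    fun s hs t _ hst => hmono s t hs hst⟩
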